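/- All vector spaces are real and finite dimensional (the zero space is allowed). A linear quaternionic structure on $E$ is an equivalence class of morphisms of associative algebras $\sigma:\mathbb{H}\to\mathrm{End}(E)$, where $\sigma\sim\sigma\circ a$ for every automorphism $a$ of $\mathbb{H}$ (these automorphisms form $\mathrm{SO}(3)$); its representatives $\sigma$ are called admissible. Put $Q=\sigma(\mathrm{Im}\,\mathbb{H})$, $\widetilde Q=\sigma(\mathbb{H})$ and $Z=\{\sigma(p)\mid p\in\mathrm{Im}\,\mathbb{H},\ |p|=1\}$; these do not depend on the choice of the admissible $\sigma$. The dual $E^*$ carries the quaternionic structure of $\sigma^*$, where $\sigma^*(p)$ is the transpose of $\sigma(\bar p)$. A *CR quaternionic vector space* $(U,E,\iota)$ consists of a vector space $U$, a quaternionic vector space $E$ and an injective linear map $\iota:U\to E$ such that $\mathrm{im}\,\iota+J(\mathrm{im}\,\iota)=E$ for all $J\in Z$. A *co-CR quaternionic vector space* $(U,E,\rho)$ consists of $U$, a quaternionic vector space $E$ and a linear map $\rho:E\to U$ (necessarily surjective) such that $(U^*,E^*,\rho^*)$ is a CR quaternionic vector space. An *$f$-quaternionic vector space* $(U,E,V)$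 consists of a quaternionic vector space $E$ and subspaces $U,V\subseteq E$ with $E=U\oplus V$ and $J(V)\subseteq U$ for all $J\in Z$; it has an underlying CR quaternionic structure, given by the inclusion $U\to E$, and an underlying co-CR quaternionic structure, given by the projection $E\to U$ along $V$. A CR quaternionic linear map $(U,E,\iota)\to(U',E',\iota')$, with respect to a map $T:Z\to Z'$, is a linear map $t:U\to U'$ for which there is a linear map $\widetilde t:E\to E'$ with $\widetilde t\circ J=T(J)\circ\widetilde t$ for all $J\in Z$ and $\iota'\circ t=\widetilde t\circ\iota$; for co-CR quaternionic linear maps the last condition is $\rho'\circ\widetilde t=t\circ\rho$. Such a map is an isomorphism if $t$ and $T$ are bijective and $t^{-1}$ is again (co-)CR quaternionic linear, with respect to $T^{-1}$. The direct product of two (co-)CR quaternionic vector spaces, with respect to the orientation preserving isometry $Z_1\to Z_2$, $\sigma_1(p)\mapsto\sigma_2(p)$, determined by admissible $\sigma_1,\sigma_2$, is $(U_1\times U_2,\,E_1\times E_2,\,\iota_1\times\iota_2)$ (respectively, with $\rho_1\times\rho_2$), where $E_1\times E_2$ has the quaternionic structure determined by $p\mapsto\sigma_1(p)\times\sigma_2(p)$.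 For a subspace $U$ of a quaternionic vector space $E$ let $$E_U=\sum_{I\in\widetilde Q}I\Bigl(\bigcap_{J\in Q\setminus\{0\}}J(U)\Bigr),\qquad E^U=\bigcap_{I\in\widetilde Q\setminus\{0\}}I\Bigl(\sum_{J\in Q}J(U)\Bigr).$$ **Theorem.** (1) Every CR quaternionic vector space is isomorphic to the direct product (with respect to some orientation preserving isometry as above) of the underlying CR quaternionic vector space of an $f$-quaternionic vector space and a CR quaternionic vector space $(U,E,\iota)$ with $E_{\iota(U)}=\{0\}$. (2) Every co-CR quaternionic vector space is isomorphic to the direct product (with respect to some orientation preserving isometry as above) of the underlying co-CR quaternionic vector space of an $f$-quaternionic vector space and a co-CR quaternionic vector space $(U,E,\rho)$ with $E^{\ker\rho}=E$. -/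

import Mathlib

section QuaternionAutomorphisms

/-- Unit imaginary quaternions square to `-1`. -/
theorem Quaternion.mul_self_of_re_eq_zero {p : Quaternion ℝ} (h0 : p.re = 0) (h1 : ‖p‖ = 1) :
    p * p = -1 := by
  have hs : star p = -p := by
    ext <;> simp [h0]
  have := Quaternion.self_mul_star p
  rw [hs, Quaternion.normSq_eq_norm_mul_self, h1] at this
  simp only [mul_neg, mul_one, Quaternion.coe_one] at this
  rw [← this, neg_neg]

/-- Conversely, quaternions with square `-1` are imaginary of unit length. -/
theorem Quaternion.re_eq_zero_of_mul_self {p : Quaternion ℝ} (h : p * p = -1) :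
    p.re = 0 ∧ ‖p‖ = 1 := by
  have h1 : ‖p‖ = 1 := by
    have := congrArg norm h
    rw [norm_mul, norm_neg, norm_one] at this
    nlinarith [norm_nonneg p]
  refine ⟨?_, h1⟩
  have hre := congrArg QuaternionAlgebra.re h
  have hi := congrArg QuaternionAlgebra.imI h
  have hj := congrArg QuaternionAlgebra.imJ h
  have hk := congrArg QuaternionAlgebra.imK h
  simp at hre hi hj hk
  by_contra hr
  have e1 : p.imI = 0 := by
    have : p.re * p.imI = 0 := by linarith
    exact (mul_eq_zero.mp this).resolve_left hr
  have e2 : p.imJ = 0 := by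
    have : p.re * p.imJ = 0 := by linarith
    exact (mul_eq_zero.mp this).resolve_left hr
  have e3 : p.imK = 0 := by
    have : p.re * p.imK = 0 := by linarith
    exact (mul_eq_zero.mp this).resolve_left hr
  rw [e1, e2, e3] at hre
  nlinarith [mul_self_nonneg p.re]

/-- Algebra automorphisms of the quaternions preserve the unit imaginary quaternions. -/
theorem Quaternion.algEquiv_unit_im (a : Quaternion ℝ ≃ₐ[ℝ] Quaternion ℝ) {p : Quaternion ℝ}
    (h0 : p.re = 0) (h1 : ‖p‖ = 1) : (a p).re = 0 ∧ ‖a p‖ = 1 := by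
  apply Quaternion.re_eq_zero_of_mul_self
  rw [← map_mul, Quaternion.mul_self_of_re_eq_zero h0 h1, map_neg, map_one]

/-- Algebra automorphisms of the quaternions commute with the conjugation. -/
theorem Quaternion.algEquiv_star (a : Quaternion ℝ ≃ₐ[ℝ] Quaternion ℝ) (p : Quaternion ℝ) :
    a (star p) = star (a p) := by
  have key : ∀ v : Quaternion ℝ, v.re = 0 → (a v).re = 0 := by
    intro v hv
    by_cases hv0 : v = 0
    · simp [hv0]
    · have hn : ‖v‖ ≠ 0 := norm_ne_zero_iff.mpr hv0
      have := (Quaternion.algEquiv_unit_im a (p := ‖v‖⁻¹ • v) (by simp [hv])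
        (by rw [norm_smul, norm_inv, norm_norm, inv_mul_cancel₀ hn])).1
      rw [map_smul] at this
      simpa [hn] using this
  have hre : (a p).re = p.re := by
    have h2 := key (p - algebraMap ℝ (Quaternion ℝ) p.re) (by simp)
    rw [map_sub, AlgEquiv.commutes] at h2
    simp at h2
    linarith
  have e : ∀ x : Quaternion ℝ, star x = algebraMap ℝ (Quaternion ℝ) (2 * x.re) - x := by
    intro x
    ext <;> simp
    ring
  rw [e p, e (a p), map_sub, AlgEquiv.commutes, hre]

end QuaternionAutomorphisms

section QuaternionicVectorSpaces

/-- A linear hypercomplex structure on a real vector space `E`: a morphism of associative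
algebras from the quaternions to `End(E)`. -/
abbrev HypercomplexStructure (E : Type*) [AddCommGroup E] [Module ℝ E] : Type _ :=
  Quaternion ℝ →ₐ[ℝ] Module.End ℝ E

/-- Two linear hypercomplex structures are equivalent if they differ by an automorphism of the
algebra of quaternions; these automorphisms form `SO(3)`, acting trivially on `ℝ` and
canonically on the imaginary quaternions. -/
instance HypercomplexStructure.setoid (E : Type*) [AddCommGroup E] [Module ℝ E] :
    Setoid (HypercomplexStructure E) where
  r σ τ := ∃ a : Quaternion ℝ ≃ₐ[ℝ] Quaternion ℝ, τ = σ.comp (a : Quaternion ℝ →ₐ[ℝ] Quaternion ℝ)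
  iseqv :=
    { refl := fun σ => ⟨AlgEquiv.refl, AlgHom.ext fun p => rfl⟩
      symm := by
        rintro σ τ ⟨a, rfl⟩
        exact ⟨a.symm, AlgHom.ext fun p => by simp⟩
      trans := by
        rintro σ τ υ ⟨a, rfl⟩ ⟨b, rfl⟩
        exact ⟨b.trans a, AlgHom.ext fun p => by simp⟩ }

/-- A linear quaternionic structure on `E`: an equivalence class of linear hypercomplex
structures. -/
def QuaternionicStructure (E : Type*) [AddCommGroup E] [Module ℝ E] : Type _ :=
  Quotient (HypercomplexStructure.setoid E)

namespace HypercomplexStructure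

variable {E : Type*} [AddCommGroup E] [Module ℝ E]
variable {E' : Type*} [AddCommGroup E'] [Module ℝ E']

/-- The linear quaternionic structure determined by a linear hypercomplex structure. -/
def toQuaternionic (σ : HypercomplexStructure E) : QuaternionicStructure E :=
  Quotient.mk _ σ

/-- The linear hypercomplex structure on the dual of `E`: the quaternion `p` acts by the
transpose of the action of its conjugate. -/
noncomputable def dual (σ : HypercomplexStructure E) : HypercomplexStructure (Module.Dual ℝ E) :=
  AlgHom.ofLinearMap
    { toFun := fun p => (σ (star p)).dualMap
      map_add' := fun p q => by ext f x; simp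
      map_smul' := fun c p => by ext f x; simp }
    (by ext f x; simp)
    (fun p q => by ext f x; simp)

theorem dual_apply (σ : HypercomplexStructure E) (p : Quaternion ℝ) :
    σ.dual p = (σ (star p)).dualMap := rfl

/-- The direct product of two linear hypercomplex structures. -/
noncomputable def prod (σ : HypercomplexStructure E) (σ' : HypercomplexStructure E') :
    HypercomplexStructure (E × E') :=
  AlgHom.ofLinearMap
    { toFun := fun p => (σ p).prodMap (σ' p)
      map_add' := fun p q => by ext x <;> simp
      map_smul' := fun c p => by ext x <;> simp }
    (by ext x <;> simp)
    (fun p q => by ext x <;> simp)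

theorem prod_apply (σ : HypercomplexStructure E) (σ' : HypercomplexStructure E')
    (p : Quaternion ℝ) : σ.prod σ' p = (σ p).prodMap (σ' p) := rfl

end HypercomplexStructure

namespace QuaternionicStructure

variable {E : Type*} [AddCommGroup E] [Module ℝ E]
variable {E' : Type*} [AddCommGroup E'] [Module ℝ E']

/-- `σ` is an admissible linear hypercomplex structure: a representative of the linear
quaternionic structure. -/
def Admissible (q : QuaternionicStructure E) (σ : HypercomplexStructure E) : Prop :=
  σ.toQuaternionic = q

/-- `Q̃ = σ(ℍ)`, where `σ` is any admissible linear hypercomplex structure. -/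
def Qtilde (q : QuaternionicStructure E) : Set (Module.End ℝ E) :=
  {A | ∃ σ, q.Admissible σ ∧ ∃ p : Quaternion ℝ, σ p = A}

/-- `Q = σ(Im ℍ)`, where `σ` is any admissible linear hypercomplex structure. -/
def Q (q : QuaternionicStructure E) : Set (Module.End ℝ E) :=
  {A | ∃ σ, q.Admissible σ ∧ ∃ p : Quaternion ℝ, p.re = 0 ∧ σ p = A}

/-- `Z`, the unit sphere of `Q`: the admissible linear complex structures. -/
def Z (q : QuaternionicStructure E) : Set (Module.End ℝ E) :=
  {A | ∃ σ, q.Admissible σ ∧ ∃ p : Quaternion ℝ, p.re = 0 ∧ ‖p‖ = 1 ∧ σ p = A}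

/-- `Z` can be computed with any admissible linear hypercomplex structure. -/
theorem mem_Z_iff {q : QuaternionicStructure E} {σ : HypercomplexStructure E}
    (hσ : q.Admissible σ) {A : Module.End ℝ E} :
    A ∈ q.Z ↔ ∃ p : Quaternion ℝ, p.re = 0 ∧ ‖p‖ = 1 ∧ σ p = A := by
  constructor
  · rintro ⟨τ, hτ, p, h0, h1, rfl⟩
    obtain ⟨a, rfl⟩ : ∃ a : Quaternion ℝ ≃ₐ[ℝ] Quaternion ℝ,
        τ = σ.comp (a : Quaternion ℝ →ₐ[ℝ] Quaternion ℝ) := Quotient.exact (hσ.trans hτ.symm)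
    obtain ⟨h0', h1'⟩ := Quaternion.algEquiv_unit_im a h0 h1
    exact ⟨a p, h0', h1', rfl⟩
  · rintro ⟨p, h0, h1, rfl⟩
    exact ⟨σ, hσ, p, h0, h1, rfl⟩

/-- Admissible linear complex structures square to `-Id`. -/
theorem sq_of_mem_Z {q : QuaternionicStructure E} {J : Module.End ℝ E} (hJ : J ∈ q.Z) (x : E) :
    J (J x) = -x := by
  obtain ⟨σ, -, p, h0, h1, rfl⟩ := hJ
  rw [← Module.End.mul_apply, ← map_mul, Quaternion.mul_self_of_re_eq_zero h0 h1]
  simp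

/-- The induced linear quaternionic structure on the dual of `E`. -/
noncomputable def dual (q : QuaternionicStructure E) : QuaternionicStructure (Module.Dual ℝ E) :=
  Quotient.map HypercomplexStructure.dual (by
    rintro σ τ ⟨a, rfl⟩
    refine ⟨a, AlgHom.ext fun p => ?_⟩
    ext f x
    simp [HypercomplexStructure.dual_apply, Quaternion.algEquiv_star]) q

/-- The dual of an admissible linear hypercomplex structure is admissible. -/
theorem Admissible.dual {q : QuaternionicStructure E} {σ : HypercomplexStructure E}
    (h : q.Admissible σ) : q.dual.Admissible σ.dual := by
  subst h; rfl

/-- `E_U`, the sum over `I ∈ Q̃` of the subspaces `I(⋂ J(U))`, the intersection being over the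
nonzero `J ∈ Q`. -/
def lowerHull (q : QuaternionicStructure E) (U : Submodule ℝ E) : Submodule ℝ E :=
  ⨆ I ∈ q.Qtilde, (⨅ J ∈ q.Q \ {0}, U.map J).map I

/-- `E^U`, the intersection over the nonzero `I ∈ Q̃` of the subspaces `I(∑ J(U))`, the sum being
over `J ∈ Q`. -/
def upperHull (q : QuaternionicStructure E) (U : Submodule ℝ E) : Submodule ℝ E :=
  ⨅ I ∈ q.Qtilde \ {0}, (⨆ J ∈ q.Q, U.map J).map I

/-- `t` is quaternionic linear with respect to the map `T` between the sets of admissible linear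
complex structures. -/
def IsQuaternionicLinear (q : QuaternionicStructure E) (q' : QuaternionicStructure E')
    (t : E →ₗ[ℝ] E') (T : q.Z → q'.Z) : Prop :=
  ∀ J : q.Z, t ∘ₗ (J : Module.End ℝ E) = (T J : Module.End ℝ E') ∘ₗ t

end QuaternionicStructure

end QuaternionicVectorSpaces

section CRStructures

variable {U E : Type*} [AddCommGroup U] [Module ℝ U] [AddCommGroup E] [Module ℝ E]

/-- For an injective linear map `ι : U → E` and a linear complex structure `J` on `E`: `(ι, J)`
induces a linear CR structure on `U`. -/
def InducesLinearCR (ι : U →ₗ[ℝ] E) (J : Module.End ℝ E) : Prop :=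
  LinearMap.range ι ⊔ (LinearMap.range ι).map J = ⊤

/-- `(E, ι)` is a linear CR quaternionic structure on `U`. -/
def IsCRQuaternionic (q : QuaternionicStructure E) (ι : U →ₗ[ℝ] E) : Prop :=
  Function.Injective ι ∧ ∀ J ∈ q.Z, InducesLinearCR ι J

/-- `(E, ρ)` is a linear co-CR quaternionic structure on `U`: its dual is a linear CR quaternionic
structure on the dual of `U` (in particular, `ρ` is surjective). -/
def IsCoCRQuaternionic (q : QuaternionicStructure E) (ρ : E →ₗ[ℝ] U) : Prop :=
  IsCRQuaternionic q.dual ρ.dualMap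

/-- `(E, V)` is a linear `f`-quaternionic structure on the subspace `U` of `E`. -/
def IsFQuaternionic (q : QuaternionicStructure E) (U V : Submodule ℝ E) : Prop :=
  IsCompl U V ∧ ∀ J ∈ q.Z, V.map J ≤ U

/-- Direct form of the definition of linear co-CR quaternionic structures. -/
theorem isCoCRQuaternionic_iff (q : QuaternionicStructure E) (ρ : E →ₗ[ℝ] U) :
    IsCoCRQuaternionic q ρ ↔ Function.Surjective ρ ∧
      ∀ J ∈ q.Z, LinearMap.ker ρ ⊓ (LinearMap.ker ρ).map J = ⊥ := by
  have hmap : ∀ J : Module.End ℝ E, (∀ x, J (J x) = -x) → ∀ K : Submodule ℝ E,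
      K.dualAnnihilator.map (-J.dualMap) = (K.map J).dualAnnihilator := by
    intro J hJ K
    ext f
    simp only [Submodule.mem_map, Submodule.mem_dualAnnihilator]
    constructor
    · rintro ⟨g, hg, rfl⟩ _ ⟨k, hk, rfl⟩
      simp [hJ, hg k hk]
    · intro hf
      refine ⟨f ∘ₗ J, fun k hk => hf _ ⟨k, hk, rfl⟩, ?_⟩
      ext x
      simp [hJ]
  have hind : ∀ J : Module.End ℝ E, (∀ x, J (J x) = -x) →
      (InducesLinearCR ρ.dualMap (-J.dualMap) ↔
        LinearMap.ker ρ ⊓ (LinearMap.ker ρ).map J = ⊥) := by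
    intro J hJ
    unfold InducesLinearCR
    rw [LinearMap.range_dualMap_eq_dualAnnihilator_ker, hmap J hJ,
      ← Subspace.dualAnnihilator_inf_eq, ← Submodule.dualAnnihilator_bot]
    exact Subspace.dualAnnihilator_inj
  unfold IsCoCRQuaternionic IsCRQuaternionic
  refine and_congr LinearMap.dualMap_injective_iff ?_
  obtain ⟨σ, hσ⟩ : ∃ σ, q.Admissible σ := Quotient.exists_rep q
  have hneg : ∀ p : Quaternion ℝ, p.re = 0 → σ.dual p = -(σ p).dualMap := by
    intro p hp
    have : star p = -p := by ext <;> simp [hp]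
    rw [HypercomplexStructure.dual_apply, this]
    ext f x
    simp
  constructor
  · intro h J hJ
    obtain ⟨p, h0, h1, rfl⟩ := (QuaternionicStructure.mem_Z_iff hσ).mp hJ
    rw [← hind _ (QuaternionicStructure.sq_of_mem_Z hJ), ← hneg p h0]
    exact h _ ((QuaternionicStructure.mem_Z_iff hσ.dual).mpr ⟨p, h0, h1, rfl⟩)
  · intro h J hJ
    obtain ⟨p, h0, h1, rfl⟩ := (QuaternionicStructure.mem_Z_iff hσ.dual).mp hJ
    have hJ' : σ p ∈ q.Z := (QuaternionicStructure.mem_Z_iff hσ).mpr ⟨p, h0, h1, rfl⟩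
    rw [hneg p h0, hind _ (QuaternionicStructure.sq_of_mem_Z hJ')]
    exact h _ hJ'

end CRStructures

/-- A (finite dimensional) CR quaternionic vector space `(U, E, ι)`. -/
structure CRQuaternionicSpace.{u, v} where
  U : Type u
  [instGroupU : AddCommGroup U]
  [instModuleU : Module ℝ U]
  [instFiniteU : FiniteDimensional ℝ U]
  E : Type v
  [instGroupE : AddCommGroup E]
  [instModuleE : Module ℝ E]
  [instFiniteE : FiniteDimensional ℝ E]
  quat : QuaternionicStructure E
  ι : U →ₗ[ℝ] E
  isCR : IsCRQuaternionic quat ι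

/-- A (finite dimensional) co-CR quaternionic vector space `(U, E, ρ)`. -/
structure CoCRQuaternionicSpace.{u, v} where
  U : Type u
  [instGroupU : AddCommGroup U]
  [instModuleU : Module ℝ U]
  [instFiniteU : FiniteDimensional ℝ U]
  E : Type v
  [instGroupE : AddCommGroup E]
  [instModuleE : Module ℝ E]
  [instFiniteE : FiniteDimensional ℝ E]
  quat : QuaternionicStructure E
  ρ : E →ₗ[ℝ] U
  isCoCR : IsCoCRQuaternionic quat ρ

/-- A (finite dimensional) `f`-quaternionic vector space `(U, E, V)`. -/
structure FQuaternionicSpace.{v} where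
  E : Type v
  [instGroupE : AddCommGroup E]
  [instModuleE : Module ℝ E]
  [instFiniteE : FiniteDimensional ℝ E]
  quat : QuaternionicStructure E
  U : Submodule ℝ E
  V : Submodule ℝ E
  isF : IsFQuaternionic quat U V

attribute [instance] CRQuaternionicSpace.instGroupU CRQuaternionicSpace.instModuleU
  CRQuaternionicSpace.instFiniteU CRQuaternionicSpace.instGroupE
  CRQuaternionicSpace.instModuleE CRQuaternionicSpace.instFiniteE
  CoCRQuaternionicSpace.instGroupU CoCRQuaternionicSpace.instModuleU
  CoCRQuaternionicSpace.instFiniteU CoCRQuaternionicSpace.instGroupE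
  CoCRQuaternionicSpace.instModuleE CoCRQuaternionicSpace.instFiniteE
  FQuaternionicSpace.instGroupE FQuaternionicSpace.instModuleE FQuaternionicSpace.instFiniteE

namespace FQuaternionicSpace

/-- The underlying CR quaternionic vector space, given by the inclusion `U → E`. -/
def toCR (F : FQuaternionicSpace) : CRQuaternionicSpace where
  U := F.U
  E := F.E
  quat := F.quat
  ι := F.U.subtype
  isCR := by
    refine ⟨Subtype.val_injective, fun J hJ => ?_⟩
    unfold InducesLinearCR
    rw [Submodule.range_subtype, eq_top_iff, ← F.isF.1.sup_eq_top]
    refine sup_le_sup_left (fun v hv => ?_) _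
    exact ⟨-J v, neg_mem (F.isF.2 J hJ ⟨v, hv, rfl⟩), by
      rw [map_neg, QuaternionicStructure.sq_of_mem_Z hJ, neg_neg]⟩

/-- The underlying co-CR quaternionic vector space, given by the projection `E → U` along `V`. -/
noncomputable def toCoCR (F : FQuaternionicSpace) : CoCRQuaternionicSpace where
  U := F.U
  E := F.E
  quat := F.quat
  ρ := F.U.projectionOnto F.V F.isF.1
  isCoCR := by
    rw [isCoCRQuaternionic_iff]
    refine ⟨LinearMap.range_eq_top.mp (Submodule.range_projectionOnto F.isF.1), fun J hJ => ?_⟩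
    rw [Submodule.ker_projectionOnto, eq_bot_iff, ← F.isF.1.inf_eq_bot, inf_comm]
    exact inf_le_inf_right _ (F.isF.2 J hJ)

end FQuaternionicSpace

namespace CRQuaternionicSpace

/-- `t` is CR quaternionic linear with respect to the map `T` between the sets of admissible
linear complex structures. -/
def IsCRQuaternionicLinear (X Y : CRQuaternionicSpace) (t : X.U →ₗ[ℝ] Y.U)
    (T : X.quat.Z → Y.quat.Z) : Prop :=
  ∃ t' : X.E →ₗ[ℝ] Y.E, X.quat.IsQuaternionicLinear Y.quat t' T ∧ Y.ι ∘ₗ t = t' ∘ₗ X.ι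

/-- CR quaternionic vector spaces are isomorphic if there is a CR quaternionic linear map between
them which has a CR quaternionic linear inverse. -/
def Isomorphic (X Y : CRQuaternionicSpace) : Prop :=
  ∃ (t : X.U ≃ₗ[ℝ] Y.U) (T : X.quat.Z ≃ Y.quat.Z),
    X.IsCRQuaternionicLinear Y t T ∧ Y.IsCRQuaternionicLinear X t.symm T.symm

/-- The direct product of two CR quaternionic vector spaces, with respect to the orientation
preserving isometry between their spheres of admissible linear complex structures which is given
by `σ(p) ↦ τ(p)`, for admissible linear hypercomplex structures `σ` and `τ`. -/
noncomputable def prod (X Y : CRQuaternionicSpace) (σ : HypercomplexStructure X.E)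
    (τ : HypercomplexStructure Y.E) (hσ : X.quat.Admissible σ) (hτ : Y.quat.Admissible τ) :
    CRQuaternionicSpace where
  U := X.U × Y.U
  E := X.E × Y.E
  quat := (σ.prod τ).toQuaternionic
  ι := X.ι.prodMap Y.ι
  isCR := by
    refine ⟨Prod.map_injective.mpr ⟨X.isCR.1, Y.isCR.1⟩, fun J hJ => ?_⟩
    obtain ⟨p, h0, h1, rfl⟩ := (QuaternionicStructure.mem_Z_iff (rfl)).mp hJ
    have hX := X.isCR.2 _ ⟨σ, hσ, p, h0, h1, rfl⟩
    have hY := Y.isCR.2 _ ⟨τ, hτ, p, h0, h1, rfl⟩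
    unfold InducesLinearCR at *
    rw [eq_top_iff]
    rintro ⟨x, y⟩ -
    have hx : x ∈ LinearMap.range X.ι ⊔ (LinearMap.range X.ι).map (σ p) := hX ▸ trivial
    have hy : y ∈ LinearMap.range Y.ι ⊔ (LinearMap.range Y.ι).map (τ p) := hY ▸ trivial
    obtain ⟨_, ⟨a, rfl⟩, _, ⟨_, ⟨b, rfl⟩, rfl⟩, rfl⟩ := Submodule.mem_sup.mp hx
    obtain ⟨_, ⟨c, rfl⟩, _, ⟨_, ⟨d, rfl⟩, rfl⟩, rfl⟩ := Submodule.mem_sup.mp hy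
    exact Submodule.mem_sup.mpr ⟨_, ⟨(a, c), rfl⟩, _, ⟨_, ⟨(b, d), rfl⟩, rfl⟩, rfl⟩

/-- `X` is the direct product of `Y` and `Y'` (with respect to some orientation preserving
isometry between their spheres of admissible linear complex structures). -/
def IsDirectProduct (X Y Y' : CRQuaternionicSpace) : Prop :=
  ∃ (σ : HypercomplexStructure Y.E) (σ' : HypercomplexStructure Y'.E)
    (hσ : Y.quat.Admissible σ) (hσ' : Y'.quat.Admissible σ'),
    X.Isomorphic (Y.prod Y' σ σ' hσ hσ')

end CRQuaternionicSpace

namespace CoCRQuaternionicSpace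

/-- `t` is co-CR quaternionic linear with respect to the map `T` between the sets of admissible
linear complex structures. -/
def IsCoCRQuaternionicLinear (X Y : CoCRQuaternionicSpace) (t : X.U →ₗ[ℝ] Y.U)
    (T : X.quat.Z → Y.quat.Z) : Prop :=
  ∃ t' : X.E →ₗ[ℝ] Y.E, X.quat.IsQuaternionicLinear Y.quat t' T ∧ Y.ρ ∘ₗ t' = t ∘ₗ X.ρ

/-- co-CR quaternionic vector spaces are isomorphic if there is a co-CR quaternionic linear map
between them which has a co-CR quaternionic linear inverse. -/
def Isomorphic (X Y : CoCRQuaternionicSpace) : Prop :=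
  ∃ (t : X.U ≃ₗ[ℝ] Y.U) (T : X.quat.Z ≃ Y.quat.Z),
    X.IsCoCRQuaternionicLinear Y t T ∧ Y.IsCoCRQuaternionicLinear X t.symm T.symm

/-- The direct product of two co-CR quaternionic vector spaces, with respect to the orientation
preserving isometry between their spheres of admissible linear complex structures which is given
by `σ(p) ↦ τ(p)`, for admissible linear hypercomplex structures `σ` and `τ`. -/
noncomputable def prod (X Y : CoCRQuaternionicSpace) (σ : HypercomplexStructure X.E)
    (τ : HypercomplexStructure Y.E) (hσ : X.quat.Admissible σ) (hτ : Y.quat.Admissible τ) :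
    CoCRQuaternionicSpace where
  U := X.U × Y.U
  E := X.E × Y.E
  quat := (σ.prod τ).toQuaternionic
  ρ := X.ρ.prodMap Y.ρ
  isCoCR := by
    have hX := (isCoCRQuaternionic_iff _ _).mp X.isCoCR
    have hY := (isCoCRQuaternionic_iff _ _).mp Y.isCoCR
    refine (isCoCRQuaternionic_iff _ _).mpr
      ⟨Prod.map_surjective.mpr ⟨hX.1, hY.1⟩, fun J hJ => ?_⟩
    obtain ⟨p, h0, h1, rfl⟩ := (QuaternionicStructure.mem_Z_iff (rfl)).mp hJ
    have hX' := hX.2 _ ⟨σ, hσ, p, h0, h1, rfl⟩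
    have hY' := hY.2 _ ⟨τ, hτ, p, h0, h1, rfl⟩
    rw [eq_bot_iff] at *
    rintro ⟨x, y⟩ ⟨hxy, ⟨a, b⟩, hab, he⟩
    have h1 : X.ρ x = 0 ∧ Y.ρ y = 0 := Prod.ext_iff.mp hxy
    have h2 : X.ρ a = 0 ∧ Y.ρ b = 0 := Prod.ext_iff.mp hab
    have h3 : σ p a = x ∧ τ p b = y := Prod.ext_iff.mp he
    have ex : x = 0 := hX' ⟨h1.1, a, h2.1, h3.1⟩
    have ey : y = 0 := hY' ⟨h1.2, b, h2.2, h3.2⟩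
    rw [ex, ey]
    exact Submodule.zero_mem _

/-- `X` is the direct product of `Y` and `Y'` (with respect to some orientation preserving
isometry between their spheres of admissible linear complex structures). -/
def IsDirectProduct (X Y Y' : CoCRQuaternionicSpace) : Prop :=
  ∃ (σ : HypercomplexStructure Y.E) (σ' : HypercomplexStructure Y'.E)
    (hσ : Y.quat.Admissible σ) (hσ' : Y'.quat.Admissible σ'),
    X.Isomorphic (Y.prod Y' σ σ' hσ hσ')

end CoCRQuaternionicSpace

universe u v

/-! Let U be a subspace of E, let W be the largest subspace with qW ⊆ U for all imaginary q
(`imCore`), and put N = W ∩ U. Then N is a quaternionic subspace. Choose V with W = N ⊕ V, so that V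
∩ U = 0 and (Im ℍ)V ⊆ U. Let φ be a real projection onto V along a complement containing U. The
operator h = φ - iφi - jφj - kφk is ℍ-linear; since φ kills (Im ℍ)V, it fixes V, so it is a
projection onto ℍV. It kills N, so adding an ℍ-linear projection g onto N gives an ℍ-linear
projection P onto ℍV ⊕ N which preserves U and is the identity on W. On the range of P, V is a
complement of the trace of U, and the structure is f-quaternionic. The kernel of P meets W
trivially, which makes the lower hull there vanish (`exists_splitting_imCore`).

The co-CR case is dual, but is argued directly with K = ker ρ and S = (Im ℍ)K (`imSpan`). Choose B
with K = (K ∩ S) ⊕ B and form h from a projection φ onto B that kills S. With g an ℍ-linear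
projection onto ℍK = K + S, the operator P = 1 - (1 - h)g splits off a kernel equal to (Im ℍ)(K ∩
ker P), while K ∩ S has no nonzero vector fixed by P (`exists_splitting_imSpan`).

Since P preserves U, respectively K, it decomposes the whole structure as a product of its range and
its kernel. -/

namespace Quaternion

/-- The quaternion `i`. -/
noncomputable def unitI : Quaternion ℝ := ⟨0, 1, 0, 0⟩

@[simp]
theorem re_unitI : unitI.re = 0 := rfl

@[simp]
theorem imI_unitI : unitI.imI = 1 := rfl

@[simp]
theorem imJ_unitI : unitI.imJ = 0 := rfl

@[simp]
theorem imK_unitI : unitI.imK = 0 := rfl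

/-- The quaternion `j`. -/
noncomputable def unitJ : Quaternion ℝ := ⟨0, 0, 1, 0⟩

@[simp]
theorem re_unitJ : unitJ.re = 0 := rfl

@[simp]
theorem imI_unitJ : unitJ.imI = 0 := rfl

@[simp]
theorem imJ_unitJ : unitJ.imJ = 1 := rfl

@[simp]
theorem imK_unitJ : unitJ.imK = 0 := rfl

/-- The quaternion `k`. -/
noncomputable def unitK : Quaternion ℝ := ⟨0, 0, 0, 1⟩

@[simp]
theorem re_unitK : unitK.re = 0 := rfl

@[simp]
theorem imI_unitK : unitK.imI = 0 := rfl

@[simp]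
theorem imJ_unitK : unitK.imJ = 0 := rfl

@[simp]
theorem imK_unitK : unitK.imK = 1 := rfl

end Quaternion

open Quaternion

/-! ### Averaging real endomorphisms into quaternionic linear ones -/

namespace HypercomplexStructure

variable {E : Type*} [AddCommGroup E] [Module ℝ E] (σ : HypercomplexStructure E)

theorem apply_eq (p : Quaternion ℝ) :
    σ p = p.re • (1 : Module.End ℝ E) + p.imI • σ unitI + p.imJ • σ unitJ
      + p.imK • σ unitK := by
  have h : p = p.re • (1 : Quaternion ℝ) + p.imI • unitI
      + p.imJ • unitJ + p.imK • unitK := by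
    ext <;> simp
  conv_lhs => rw [h]
  simp only [map_add, map_smul, map_one]

theorem apply_apply_im {p : Quaternion ℝ} (hp : p.re = 0) (x : E) :
    σ p (σ p x) = -(‖p‖ ^ 2 • x) := by
  have hs : star p = -p := by ext <;> simp [hp]
  have h := Quaternion.self_mul_star p
  rw [hs, mul_neg, neg_eq_iff_eq_neg, Quaternion.normSq_eq_norm_mul_self] at h
  rw [← Module.End.mul_apply, ← map_mul, h, map_neg, LinearMap.neg_apply, sq]
  congr 1
  exact LinearMap.congr_fun (AlgHom.commutes σ _) x

/-- The quaternionic linear endomorphism whose "real part" is a given real linear endomorphism. -/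
noncomputable def linearize (f : Module.End ℝ E) : Module.End ℝ E :=
  f - σ unitI * f * σ unitI - σ unitJ * f * σ unitJ
    - σ unitK * f * σ unitK

theorem linearize_apply (f : Module.End ℝ E) (x : E) :
    σ.linearize f x = f x - σ unitI (f (σ unitI x))
      - σ unitJ (f (σ unitJ x)) - σ unitK (f (σ unitK x)) := rfl

/-- Up to a factor this is the average of f under conjugation by the group {±1, ±i, ±j, ±k}, so it
commutes with i, j and k; the multiplication table verifies this. -/
theorem linearize_commute (f : Module.End ℝ E) (p : Quaternion ℝ) (x : E) :
    σ.linearize f (σ p x) = σ p (σ.linearize f x) := by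
  have ii : unitI * unitI = -1 := by ext <;> simp
  have jj : unitJ * unitJ = -1 := by ext <;> simp
  have kk : unitK * unitK = -1 := by ext <;> simp
  have ij : unitI * unitJ = unitK := by ext <;> simp
  have ji : unitJ * unitI = -unitK := by ext <;> simp
  have jk : unitJ * unitK = unitI := by ext <;> simp
  have kj : unitK * unitJ = -unitI := by ext <;> simp
  have ki : unitK * unitI = unitJ := by ext <;> simp
  have ik : unitI * unitK = -unitJ := by ext <;> simp
  have key : ∀ (p q r : Quaternion ℝ), p * q = r → ∀ y, σ p (σ q y) = σ r y := by
    rintro p q r rfl y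
    rw [map_mul, Module.End.mul_apply]
  rw [apply_eq σ p]
  simp only [LinearMap.add_apply, LinearMap.smul_apply, Module.End.one_apply, map_add, map_smul,
    linearize_apply, map_sub, key _ _ _ ii, key _ _ _ jj, key _ _ _ kk, key _ _ _ ij,
    key _ _ _ ji, key _ _ _ jk, key _ _ _ kj, key _ _ _ ki, key _ _ _ ik, map_neg, map_one,
    LinearMap.neg_apply, Module.End.one_apply]
  module

/-- A subspace which is invariant under the quaternions is the image of a quaternionic linear
projection. -/
theorem exists_projection {N : Submodule ℝ E} (hN : ∀ p, ∀ x ∈ N, σ p x ∈ N) :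
    ∃ g : Module.End ℝ E, (∀ p x, g (σ p x) = σ p (g x)) ∧ (∀ x, g x ∈ N) ∧
      ∀ x ∈ N, g x = x := by
  obtain ⟨C, hC⟩ := N.exists_isCompl
  -- On the invariant subspace N each of the four terms of `linearize` acts as the identity, hence
  -- the factor 1/4.
  refine ⟨(1 / 4 : ℝ) • σ.linearize (N.projection C hC), fun p x => ?_, fun x => ?_,
    fun x hx => ?_⟩
  · simp only [LinearMap.smul_apply, linearize_commute, map_smul]
  · refine N.smul_mem _ ?_
    rw [linearize_apply]
    have := fun y => Submodule.projection_apply_mem hC y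
    exact N.sub_mem (N.sub_mem (N.sub_mem (this _) (hN _ _ (this _))) (hN _ _ (this _)))
      (hN _ _ (this _))
  · rw [LinearMap.smul_apply, linearize_apply]
    simp only [Submodule.projection_apply_of_mem_left hC hx,
      Submodule.projection_apply_of_mem_left hC (hN _ x hx)]
    rw [apply_apply_im _ rfl, apply_apply_im _ rfl, apply_apply_im _ rfl]
    have h : ∀ p : Quaternion ℝ, ‖p‖ ^ 2 = p.re ^ 2 + p.imI ^ 2 + p.imJ ^ 2 + p.imK ^ 2 := by
      intro p
      rw [sq, ← Quaternion.normSq_eq_norm_mul_self, Quaternion.normSq_def']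
    simp [h]
    module

/-! ### Imaginary span and imaginary core of a subspace -/

/-- The span of the images of a subspace under the imaginary quaternions. -/
noncomputable def imSpan (K : Submodule ℝ E) : Submodule ℝ E :=
  Submodule.span ℝ {y | ∃ p : Quaternion ℝ, p.re = 0 ∧ ∃ x ∈ K, σ p x = y}

theorem apply_mem_imSpan {K : Submodule ℝ E} {p : Quaternion ℝ} (hp : p.re = 0) {x : E}
    (hx : x ∈ K) : σ p x ∈ σ.imSpan K :=
  Submodule.subset_span ⟨p, hp, x, hx, rfl⟩

theorem imSpan_le {K S : Submodule ℝ E} :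
    σ.imSpan K ≤ S ↔ ∀ p : Quaternion ℝ, p.re = 0 → ∀ x ∈ K, σ p x ∈ S := by
  refine Submodule.span_le.trans ⟨fun h p hp x hx => h ⟨p, hp, x, hx, rfl⟩, ?_⟩
  rintro h _ ⟨p, hp, x, hx, rfl⟩
  exact h p hp x hx

/-- The largest subspace which is mapped into a given subspace by the imaginary quaternions. -/
noncomputable def imCore (U : Submodule ℝ E) : Submodule ℝ E :=
  ⨅ p : {p : Quaternion ℝ // p.re = 0}, U.comap (σ p)

theorem mem_imCore {U : Submodule ℝ E} {x : E} :
    x ∈ σ.imCore U ↔ ∀ p : Quaternion ℝ, p.re = 0 → σ p x ∈ U := by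
  simp [imCore]

theorem apply_eq_re_add_im (p : Quaternion ℝ) (x : E) :
    σ p x = p.re • x + σ (p - (p.re : Quaternion ℝ)) x := by
  rw [map_sub, LinearMap.sub_apply]
  have : σ (p.re : Quaternion ℝ) x = p.re • x := LinearMap.congr_fun (AlgHom.commutes σ _) x
  rw [this]
  abel

theorem apply_mem_of_mem_imCore {U : Submodule ℝ E} {x : E} (hx : x ∈ σ.imCore U) (hxU : x ∈ U)
    (p : Quaternion ℝ) : σ p x ∈ U := by
  rw [apply_eq_re_add_im]
  exact U.add_mem (U.smul_mem _ hxU) ((σ.mem_imCore).mp hx _ (by simp))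

/-- Splitting quaternions into real and imaginary parts shows that K + (Im ℍ)K is ℍK, the
quaternionic span of K. -/
theorem apply_mem_sup_imSpan {K : Submodule ℝ E} (p : Quaternion ℝ) {x : E}
    (hx : x ∈ K ⊔ σ.imSpan K) : σ p x ∈ K ⊔ σ.imSpan K := by
  have key : ∀ q : Quaternion ℝ, ∀ y ∈ K, σ q y ∈ K ⊔ σ.imSpan K := by
    intro q y hy
    rw [apply_eq_re_add_im]
    exact Submodule.add_mem_sup (K.smul_mem _ hy) (σ.apply_mem_imSpan (by simp) hy)
  have : K ⊔ σ.imSpan K ≤ (K ⊔ σ.imSpan K).comap (σ p) := by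
    refine sup_le (fun y hy => key p y hy) ((σ.imSpan_le).mpr fun q _ y hy => ?_)
    rw [Submodule.mem_comap, ← Module.End.mul_apply, ← map_mul]
    exact key _ y hy
  exact this hx

/-! ### The two quaternionic splittings -/

/-- If `V` meets trivially a subspace `S` which contains the images of `V` under the imaginary
quaternions then there is a quaternionic linear projection onto the quaternionic span of `V`, whose
real part vanishes on `S`. -/
theorem exists_linearize_projection {V S : Submodule ℝ E} (hVS : Disjoint V S)
    (h : σ.imSpan V ≤ S) :
    ∃ φ : Module.End ℝ E, (∀ x, φ x ∈ V) ∧ (∀ x ∈ V, φ x = x) ∧ (∀ x ∈ S, φ x = 0) ∧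
      ∀ x ∈ V, σ.linearize φ x = x := by
  -- Projecting along a complement that contains S kills qv for imaginary q and v ∈ V, so only the
  -- first term of `linearize` survives on V.
  obtain ⟨C, hSC, hC⟩ := hVS.symm.exists_isCompl
  have h0 : ∀ x ∈ S, V.projection C hC.symm x = 0 := fun x hx =>
    Submodule.projection_apply_of_mem_right hC.symm (hSC hx)
  refine ⟨V.projection C hC.symm, Submodule.projection_apply_mem _,
    fun x hx => Submodule.projection_apply_of_mem_left _ hx, h0, fun x hx => ?_⟩
  have h1 := fun p hp => h0 _ (h (σ.apply_mem_imSpan (p := p) hp hx))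
  simp [linearize_apply, h1 _ re_unitI, h1 _ re_unitJ, h1 _ re_unitK,
    Submodule.projection_apply_of_mem_left _ hx]

/-- The values of `linearize φ` lie in ℍV, where it is the identity by ℍ-linearity. -/
theorem linearize_linearize {V : Submodule ℝ E} {φ : Module.End ℝ E} (h0 : ∀ x, φ x ∈ V)
    (h1 : ∀ x ∈ V, σ.linearize φ x = x) (x : E) :
    σ.linearize φ (σ.linearize φ x) = σ.linearize φ x := by
  conv_lhs => rw [linearize_apply σ φ x]
  simp only [map_sub, linearize_commute, h1 _ (h0 _)]
  rfl

/-- The range of P will carry the f-quaternionic factor, with V as the distinguished complement; P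
being the identity on `imCore U` makes the core trivial on ker P. -/
theorem exists_splitting_imCore (U : Submodule ℝ E) :
    ∃ (P : Module.End ℝ E) (V : Submodule ℝ E), (∀ p x, P (σ p x) = σ p (P x)) ∧
      (∀ x, P (P x) = P x) ∧ (∀ x ∈ U, P x ∈ U) ∧ (∀ x ∈ σ.imCore U, P x = x) ∧
      V ≤ σ.imCore U ∧ Disjoint U V ∧ ∀ x, ∃ v ∈ V, P x - v ∈ U := by
  obtain ⟨V, hd, hs⟩ := IsModularLattice.exists_disjoint_and_sup_eq (inf_le_left : σ.imCore U ⊓ U ≤ σ.imCore U)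
  have hVW : V ≤ σ.imCore U := hs ▸ le_sup_right
  have hVU : Disjoint V U := by
    rw [Submodule.disjoint_def] at hd ⊢
    exact fun x hx hxU => hd x ⟨hVW hx, hxU⟩ hx
  -- For x in the core and in U all of ℍx lies in U, so q(px) = (qp)x ∈ U.
  have hN : ∀ p, ∀ x ∈ σ.imCore U ⊓ U, σ p x ∈ σ.imCore U ⊓ U := by
    refine fun p x hx => ⟨(σ.mem_imCore).mpr fun q _ => ?_, σ.apply_mem_of_mem_imCore hx.1 hx.2 p⟩
    rw [← Module.End.mul_apply, ← map_mul]
    exact σ.apply_mem_of_mem_imCore hx.1 hx.2 _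
  have hQV : σ.imSpan V ≤ U := (σ.imSpan_le).mpr fun p hp x hx => (σ.mem_imCore).mp (hVW hx) p hp
  obtain ⟨φ, hφV, -, hφ0, hφ⟩ := σ.exists_linearize_projection hVU hQV
  obtain ⟨g, hgσ, hgN, hg⟩ := σ.exists_projection hN
  have hQ : ∀ p x, p.re = 0 → σ p (φ x) ∈ U := fun p x hp => hQV (σ.apply_mem_imSpan hp (hφV x))
  -- The three remaining terms of `linearize φ x` lie in (Im ℍ)V ⊆ U.
  have hsub : ∀ x, σ.linearize φ x - φ x ∈ U := by
    intro x
    rw [linearize_apply]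
    have := U.neg_mem (U.add_mem (U.add_mem (hQ unitI (σ unitI x) rfl)
      (hQ unitJ (σ unitJ x) rfl)) (hQ unitK (σ unitK x) rfl))
    convert this using 1
    abel
  have h0 : ∀ x ∈ σ.imCore U ⊓ U, σ.linearize φ x = 0 := by
    intro x hx
    simp [linearize_apply, hφ0 _ hx.2, hφ0 _ (hN _ x hx).2]
  have hP : ∀ x, (σ.linearize φ + g * (1 - σ.linearize φ)) x
      = σ.linearize φ x + g (x - σ.linearize φ x) := fun x => rfl
  -- With h = `linearize φ` vanishing on N, the operator h + g(1 - h) is a projection onto ℍV ⊕ N,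
  -- even though g need not vanish on ℍV.
  refine ⟨σ.linearize φ + g * (1 - σ.linearize φ), V, fun p x => ?_, fun x => ?_, fun x hx => ?_,
    fun x hx => ?_, hVW, hVU.symm, fun x => ⟨φ x, hφV x, ?_⟩⟩
  · simp only [hP, linearize_commute, map_sub, hgσ, map_add]
  · simp only [hP]
    rw [map_add, linearize_linearize σ hφV hφ, h0 _ (hgN _), add_zero, add_sub_cancel_left,
      hg _ (hgN _)]
  · rw [hP]
    have := hsub x
    rw [hφ0 x hx, sub_zero] at this
    exact U.add_mem this (hgN _).2
  · rw [← hs] at hx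
    obtain ⟨u, hu, v, hv, rfl⟩ := Submodule.mem_sup.mp hx
    rw [hP, map_add, h0 u hu, hφ v hv, zero_add, add_sub_cancel_right, hg u hu, add_comm]
  · rw [hP, add_sub_right_comm]
    exact U.add_mem (hsub x) (hgN _).2

/-- Dual to `exists_splitting_imCore`: the kernel of P is the imaginary span of its part of K, and
on the range the part of K is disjoint from (Im ℍ)K, which leaves room for an f-quaternionic
complement. -/
theorem exists_splitting_imSpan (K : Submodule ℝ E) :
    ∃ P : Module.End ℝ E, (∀ p x, P (σ p x) = σ p (P x)) ∧ (∀ x, P (P x) = P x) ∧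
      (∀ x ∈ K, P x ∈ K) ∧ (∀ x, P x = 0 → x ∈ σ.imSpan (K ⊓ LinearMap.ker P)) ∧
      ∀ x ∈ K, x ∈ σ.imSpan K → P x = x → x = 0 := by
  obtain ⟨B, hd, hs⟩ := IsModularLattice.exists_disjoint_and_sup_eq (inf_le_left : K ⊓ σ.imSpan K ≤ K)
  have hBK : B ≤ K := hs ▸ le_sup_right
  have hBS : Disjoint B (σ.imSpan K) := by
    rw [Submodule.disjoint_def] at hd ⊢
    exact fun x hx hxS => hd x ⟨hBK hx, hxS⟩ hx
  have hQB : σ.imSpan B ≤ σ.imSpan K :=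
    (σ.imSpan_le).mpr fun p hp x hx => σ.apply_mem_imSpan hp (hBK hx)
  obtain ⟨φ, hφB, hφ1, hφ0, hφ⟩ := σ.exists_linearize_projection hBS hQB
  obtain ⟨g, hgσ, hgN, hg⟩ := σ.exists_projection fun p x => σ.apply_mem_sup_imSpan (K := K) p
  -- For x ∈ K the vectors ix, jx, kx lie in S = (Im ℍ)K, which φ kills.
  have hK : ∀ x ∈ K, σ.linearize φ x = φ x := by
    intro x hx
    have h1 := fun p hp => hφ0 _ (σ.apply_mem_imSpan (p := p) hp hx)
    simp [linearize_apply, h1 _ re_unitI, h1 _ re_unitJ, h1 _ re_unitK]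
  have hgK : ∀ x ∈ K, g x = x := fun x hx => hg x (Submodule.mem_sup_left hx)
  have hsub : ∀ x ∈ K, x - φ x ∈ K ⊓ σ.imSpan K := by
    intro x hx
    rw [← hs] at hx
    obtain ⟨u, hu, v, hv, rfl⟩ := Submodule.mem_sup.mp hx
    rwa [map_add, hφ0 u hu.2, hφ1 v hv, zero_add, add_sub_cancel_right]
  -- With h = `linearize φ`, (1 - h)g projects onto the kernel of h in ℍK; its complementary
  -- projection P has that space as kernel and agrees with h on ℍK.
  have hP : ∀ x, (1 - (1 - σ.linearize φ) * g : Module.End ℝ E) x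
      = x - (g x - σ.linearize φ (g x)) := fun x => rfl
  have hPK : ∀ x ∈ K, (1 - (1 - σ.linearize φ) * g : Module.End ℝ E) x = φ x := by
    intro x hx
    rw [hP, hgK x hx, hK x hx, sub_sub_cancel]
  have hh := σ.linearize_linearize hφB hφ
  have hhN : ∀ x, g (σ.linearize φ x) = σ.linearize φ x := by
    intro x
    have : ∀ y, φ y ∈ K := fun y => hBK (hφB y)
    conv_lhs => rw [linearize_apply]
    simp only [map_sub, hgσ, hgK _ (this _)]
    rfl
  set P : Module.End ℝ E := 1 - (1 - σ.linearize φ) * g with hPdef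
  have hker : ∀ x ∈ K, x - φ x ∈ K ⊓ LinearMap.ker P := by
    refine fun x hx => ⟨(hsub x hx).1, LinearMap.mem_ker.mpr ?_⟩
    rw [hPK _ (hsub x hx).1, hφ0 _ (hsub x hx).2]
  -- By ℍ-linearity (1 - h)(px) = p(x - φx) for x ∈ K, and x - φx ∈ K ∩ ker P.
  have hS : σ.imSpan K ≤ (σ.imSpan (K ⊓ LinearMap.ker P)).comap (1 - σ.linearize φ) := by
    refine (σ.imSpan_le).mpr fun p hp x hx => ?_
    have : (1 - σ.linearize φ) (σ p x) = σ p (x - φ x) := by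
      rw [LinearMap.sub_apply, Module.End.one_apply, linearize_commute, hK x hx, map_sub]
    rw [Submodule.mem_comap, this]
    exact σ.apply_mem_imSpan hp (hker x hx)
  refine ⟨P, fun p x => ?_, fun x => ?_, fun x hx => ?_, fun x hx => ?_, fun x hx hxS he => ?_⟩
  · simp only [hP, hgσ, linearize_commute, map_sub]
  · simp only [hP, map_sub, hhN, hg _ (hgN _), hh]
    abel
  · rw [hPK x hx]
    exact hBK (hφB x)
  · rw [hP, sub_eq_zero] at hx
    obtain ⟨y, hy, z, hz, hyz⟩ := Submodule.mem_sup.mp (hgN x)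
    -- Since 1 - h kills φy ∈ B, the vector y ∈ K may be replaced by y - φy, which lies in (Im ℍ)K
    -- like z.
    have h1 : x = (1 - σ.linearize φ) (y - φ y) + (1 - σ.linearize φ) z := by
      have : (1 - σ.linearize φ) (φ y) = 0 := by
        rw [LinearMap.sub_apply, hφ _ (hφB y), Module.End.one_apply, sub_self]
      rw [map_sub, this, sub_zero, ← map_add, hyz]
      exact hx
    rw [h1]
    exact Submodule.add_mem _ (hS (hsub y hy).2) (hS hz)
  · rw [← he, hPK x hx, hφ0 x hxS]

/-- The restriction of a linear hypercomplex structure to an invariant subspace. -/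
noncomputable def restrict {A : Submodule ℝ E} (hA : ∀ p, ∀ x ∈ A, σ p x ∈ A) :
    HypercomplexStructure A :=
  AlgHom.ofLinearMap
    { toFun := fun p => (σ p).restrict (hA p)
      map_add' := fun p q => by ext x; simp
      map_smul' := fun c p => by ext x; simp }
    (by ext x; simp)
    (fun p q => by ext x; simp)

end HypercomplexStructure

/-- The splitting of a vector space which is determined by a projection. -/
def LinearMap.prodEquivOfIdempotent {E : Type*} [AddCommGroup E] [Module ℝ E]
    (P : Module.End ℝ E) (h : ∀ x, P (P x) = P x) :
    E ≃ₗ[ℝ] LinearMap.range P × LinearMap.ker P where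
  toFun x := (P.rangeRestrict x, ⟨x - P x, by simp [h]⟩)
  map_add' x y := by ext <;> simp [add_sub_add_comm]
  map_smul' c x := by ext <;> simp [smul_sub]
  invFun z := z.1 + z.2
  left_inv x := by simp
  right_inv := by
    rintro ⟨⟨_, x, rfl⟩, ⟨y, hy⟩⟩
    rw [LinearMap.mem_ker] at hy
    ext <;> simp [h, hy]

/-! ### Hulls, and isomorphisms induced from the ambient space -/

namespace QuaternionicStructure

variable {E : Type*} [AddCommGroup E] [Module ℝ E]

theorem map_mem_Q {q : QuaternionicStructure E} {σ : HypercomplexStructure E}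
    (hσ : q.Admissible σ) {p : Quaternion ℝ} (hp : p.re = 0) : σ p ∈ q.Q :=
  ⟨σ, hσ, p, hp, rfl⟩

/-- For J = σ(p) with p imaginary, J² = -|p|², so x ∈ J(U) gives Jx ∈ U; J = 0, absent from the
intersection, is harmless. -/
theorem iInf_map_Q_le_imCore {q : QuaternionicStructure E} {σ : HypercomplexStructure E}
    (hσ : q.Admissible σ) (U : Submodule ℝ E) :
    ⨅ J ∈ q.Q \ {0}, U.map J ≤ σ.imCore U := by
  intro x hx
  rw [HypercomplexStructure.mem_imCore]
  intro p hp
  by_cases h0 : σ p = 0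
  · simp [h0]
  · simp only [Submodule.mem_iInf] at hx
    obtain ⟨u, hu, rfl⟩ := hx (σ p) ⟨map_mem_Q hσ hp, h0⟩
    rw [σ.apply_apply_im hp]
    exact U.neg_mem (U.smul_mem _ hu)

theorem lowerHull_eq_bot {q : QuaternionicStructure E} {σ : HypercomplexStructure E}
    (hσ : q.Admissible σ) {U : Submodule ℝ E} (h : σ.imCore U = ⊥) : q.lowerHull U = ⊥ := by
  have : ⨅ J ∈ q.Q \ {0}, U.map J = ⊥ := eq_bot_iff.mpr (h ▸ iInf_map_Q_le_imCore hσ U)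
  simp only [lowerHull, this, Submodule.map_bot, iSup_bot]

/-- The inner sum is everything, and each nonzero I ∈ Q̃ is invertible because ℍ is a division
algebra. -/
theorem upperHull_eq_top {q : QuaternionicStructure E} {σ : HypercomplexStructure E}
    (hσ : q.Admissible σ) {K : Submodule ℝ E} (h : σ.imSpan K = ⊤) : q.upperHull K = ⊤ := by
  have hK : ⨆ J ∈ q.Q, K.map J = ⊤ := by
    rw [eq_top_iff, ← h, HypercomplexStructure.imSpan_le]
    intro p hp x hx
    exact Submodule.mem_iSup_of_mem (σ p)
      (Submodule.mem_iSup_of_mem (map_mem_Q hσ hp) ⟨x, hx, rfl⟩)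
  rw [upperHull, hK]
  simp only [iInf_eq_top]
  rintro _ ⟨⟨τ, -, p, rfl⟩, h0⟩
  have hp : p ≠ 0 := by
    rintro rfl
    exact h0 (map_zero τ)
  rw [eq_top_iff]
  intro x _
  refine ⟨τ p⁻¹ x, trivial, ?_⟩
  rw [← Module.End.mul_apply, ← map_mul, mul_inv_cancel₀ hp, map_one, Module.End.one_apply]

variable {E' : Type*} [AddCommGroup E'] [Module ℝ E']

/-- A linear isomorphism which intertwines admissible linear hypercomplex structures is
quaternionic linear, and so is its inverse. -/
theorem exists_equiv_isQuaternionicLinear {q : QuaternionicStructure E}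
    {q' : QuaternionicStructure E'} {σ : HypercomplexStructure E} {τ : HypercomplexStructure E'}
    (hσ : q.Admissible σ) (hτ : q'.Admissible τ) (e : E ≃ₗ[ℝ] E')
    (he : ∀ p x, e (σ p x) = τ p (e x)) :
    ∃ T : q.Z ≃ q'.Z, q.IsQuaternionicLinear q' (e : E →ₗ[ℝ] E') T ∧
      q'.IsQuaternionicLinear q (e.symm : E' →ₗ[ℝ] E) T.symm := by
  have hconj : ∀ p, e.conj (σ p) = τ p := by
    intro p
    ext y
    simp [LinearEquiv.conj_apply, he]
  have hconj' : ∀ p, e.symm.conj (τ p) = σ p := by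
    intro p
    rw [← hconj]
    ext y
    simp [LinearEquiv.conj_apply]
  let T : q.Z ≃ q'.Z :=
    { toFun := fun J => ⟨e.conj J, by
        obtain ⟨p, h0, h1, h⟩ := (mem_Z_iff hσ).mp J.2
        exact (mem_Z_iff hτ).mpr ⟨p, h0, h1, by rw [← h, hconj]⟩⟩
      invFun := fun J => ⟨e.symm.conj J, by
        obtain ⟨p, h0, h1, h⟩ := (mem_Z_iff hτ).mp J.2
        exact (mem_Z_iff hσ).mpr ⟨p, h0, h1, by rw [← h, hconj']⟩⟩
      left_inv := fun J => by
        ext x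
        simp [LinearEquiv.conj_apply]
      right_inv := fun J => by
        ext x
        simp [LinearEquiv.conj_apply] }
  refine ⟨T, fun J => ?_, fun J => ?_⟩
  · ext x
    simp [T, LinearEquiv.conj_apply]
  · ext x
    simp [T, LinearEquiv.conj_apply]

end QuaternionicStructure

namespace CRQuaternionicSpace

/-- As ι is injective, the map t is the restriction of e to the images, and T is conjugation by e.
-/
theorem isomorphic_of_linearEquiv {X : CRQuaternionicSpace} {Y : CRQuaternionicSpace}
    {σ : HypercomplexStructure X.E} {τ : HypercomplexStructure Y.E} (hσ : X.quat.Admissible σ)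
    (hτ : Y.quat.Admissible τ) (e : X.E ≃ₗ[ℝ] Y.E) (he : ∀ p x, e (σ p x) = τ p (e x))
    (hr : ∀ x, x ∈ LinearMap.range X.ι ↔ e x ∈ LinearMap.range Y.ι) : X.Isomorphic Y := by
  obtain ⟨T, hT, hT'⟩ :=
    QuaternionicStructure.exists_equiv_isQuaternionicLinear hσ hτ e he
  have hmap : (LinearMap.range X.ι).map (e : X.E →ₗ[ℝ] Y.E) = LinearMap.range Y.ι := by
    ext y
    constructor
    · rintro ⟨x, hx, rfl⟩
      exact (hr x).mp hx
    · intro hy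
      exact ⟨e.symm y, (hr _).mpr (by simpa using hy), by simp⟩
  let t : X.U ≃ₗ[ℝ] Y.U := LinearEquiv.ofInjective X.ι X.isCR.1 ≪≫ₗ e.submoduleMap _ ≪≫ₗ
    LinearEquiv.ofEq _ _ hmap ≪≫ₗ (LinearEquiv.ofInjective Y.ι Y.isCR.1).symm
  have ht : ∀ u, Y.ι (t u) = e (X.ι u) := by
    intro u
    rw [← LinearEquiv.ofInjective_apply Y.ι (h := Y.isCR.1)]
    simp [t]
  refine ⟨t, T, ⟨e, hT, LinearMap.ext ht⟩, ⟨e.symm, hT', LinearMap.ext fun u => ?_⟩⟩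
  obtain ⟨u, rfl⟩ := t.surjective u
  simp [ht]

end CRQuaternionicSpace

namespace CoCRQuaternionicSpace

/-- As ρ is surjective, the map t is the one that e induces on the quotients by the kernels. -/
theorem isomorphic_of_linearEquiv {X : CoCRQuaternionicSpace} {Y : CoCRQuaternionicSpace}
    {σ : HypercomplexStructure X.E} {τ : HypercomplexStructure Y.E} (hσ : X.quat.Admissible σ)
    (hτ : Y.quat.Admissible τ) (e : X.E ≃ₗ[ℝ] Y.E) (he : ∀ p x, e (σ p x) = τ p (e x))
    (hk : ∀ x, x ∈ LinearMap.ker X.ρ ↔ e x ∈ LinearMap.ker Y.ρ) : X.Isomorphic Y := by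
  obtain ⟨T, hT, hT'⟩ :=
    QuaternionicStructure.exists_equiv_isQuaternionicLinear hσ hτ e he
  have hX := ((isCoCRQuaternionic_iff _ _).mp X.isCoCR).1
  have hY := ((isCoCRQuaternionic_iff _ _).mp Y.isCoCR).1
  have hmap : (LinearMap.ker X.ρ).map (e : X.E →ₗ[ℝ] Y.E) = LinearMap.ker Y.ρ := by
    ext y
    constructor
    · rintro ⟨x, hx, rfl⟩
      exact (hk x).mp hx
    · intro hy
      exact ⟨e.symm y, (hk _).mpr (by simpa using hy), by simp⟩
  let t : X.U ≃ₗ[ℝ] Y.U := (X.ρ.quotKerEquivOfSurjective hX).symm ≪≫ₗ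
    Submodule.Quotient.equiv _ _ e hmap ≪≫ₗ Y.ρ.quotKerEquivOfSurjective hY
  have ht : ∀ x, t (X.ρ x) = Y.ρ (e x) := by
    intro x
    have : (X.ρ.quotKerEquivOfSurjective hX).symm (X.ρ x) = Submodule.Quotient.mk x := by
      rw [LinearEquiv.symm_apply_eq]
      rfl
    simp only [t, LinearEquiv.trans_apply, this]
    rfl
  refine ⟨t, T, ⟨e, hT, LinearMap.ext fun x => (ht x).symm⟩,
    ⟨e.symm, hT', LinearMap.ext fun y => ?_⟩⟩
  obtain ⟨x, rfl⟩ := e.surjective y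
  simp [← ht]

end CoCRQuaternionicSpace

/-! ### Assembling the direct products -/

theorem CRQuaternionicSpace.exists_isDirectProduct (X : CRQuaternionicSpace.{u, v}) :
    ∃ (F : FQuaternionicSpace.{v}) (Y : CRQuaternionicSpace.{u, v}),
      Y.quat.lowerHull (LinearMap.range Y.ι) = ⊥ ∧ X.IsDirectProduct F.toCR Y := by
  obtain ⟨σ, hσ⟩ : ∃ σ, X.quat.Admissible σ := Quotient.exists_rep X.quat
  obtain ⟨P, V, hPσ, hPP, hPU, hP, hVW, hVU, hPV⟩ :=
    σ.exists_splitting_imCore (LinearMap.range X.ι)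
  have hA : ∀ p, ∀ x ∈ LinearMap.range P, σ p x ∈ LinearMap.range P := by
    rintro p _ ⟨x, rfl⟩
    exact ⟨σ p x, hPσ p x⟩
  have hB : ∀ p, ∀ x ∈ LinearMap.ker P, σ p x ∈ LinearMap.ker P := by
    intro p x hx
    rw [LinearMap.mem_ker] at hx ⊢
    rw [hPσ, hx, map_zero]
  let F : FQuaternionicSpace.{v} :=
    { E := LinearMap.range P
      quat := (σ.restrict hA).toQuaternionic
      U := (LinearMap.range X.ι).comap (LinearMap.range P).subtype
      V := V.comap (LinearMap.range P).subtype
      isF := by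
        refine ⟨⟨?_, ?_⟩, ?_⟩
        · rw [Submodule.disjoint_def]
          intro x hx hx'
          exact Subtype.ext (Submodule.disjoint_def.mp hVU _ hx hx')
        · rw [codisjoint_iff, eq_top_iff]
          rintro ⟨_, x, rfl⟩ -
          obtain ⟨v, hv, hu⟩ := hPV x
          have hvP : v ∈ LinearMap.range P := ⟨v, hP v (hVW hv)⟩
          refine Submodule.mem_sup.mpr ⟨⟨P x - v, sub_mem ⟨x, rfl⟩ hvP⟩, hu, ⟨v, hvP⟩, hv, ?_⟩
          ext
          simp
        · intro J hJ
          obtain ⟨p, h0, -, rfl⟩ := (QuaternionicStructure.mem_Z_iff rfl).mp hJ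
          rintro _ ⟨x, hx, rfl⟩
          exact (σ.mem_imCore).mp (hVW hx) p h0 }
  let Y : CRQuaternionicSpace.{u, v} :=
    { U := (LinearMap.ker P).comap X.ι
      E := LinearMap.ker P
      quat := (σ.restrict hB).toQuaternionic
      ι := X.ι.restrict fun x hx => hx
      isCR := by
        refine ⟨fun x y h => Subtype.ext (X.isCR.1 (congrArg Subtype.val h)), fun J hJ => ?_⟩
        obtain ⟨p, h0, h1, rfl⟩ := (QuaternionicStructure.mem_Z_iff rfl).mp hJ
        have hX : LinearMap.range X.ι ⊔ (LinearMap.range X.ι).map (σ p) = ⊤ :=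
          X.isCR.2 _ ((QuaternionicStructure.mem_Z_iff hσ).mpr ⟨p, h0, h1, rfl⟩)
        -- The projection 1 - P sends im ι into im ι ∩ ker P and commutes with J, so it carries the
        -- CR condition over to ker P.
        have key : ∀ a, ∃ b : (LinearMap.ker P).comap X.ι, X.ι b = X.ι a - P (X.ι a) := by
          intro a
          obtain ⟨b, hb⟩ := hPU _ ⟨a, rfl⟩
          have hab : X.ι (a - b) = X.ι a - P (X.ι a) := by rw [map_sub, hb]
          refine ⟨⟨a - b, ?_⟩, hab⟩
          rw [Submodule.mem_comap, hab, LinearMap.mem_ker, map_sub, hPP, sub_self]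
        unfold InducesLinearCR
        rw [eq_top_iff]
        rintro ⟨x, hx⟩ -
        have hx' : x ∈ LinearMap.range X.ι ⊔ (LinearMap.range X.ι).map (σ p) := hX ▸ trivial
        obtain ⟨_, ⟨a, rfl⟩, _, ⟨_, ⟨b, rfl⟩, rfl⟩, rfl⟩ := Submodule.mem_sup.mp hx'
        obtain ⟨a', ha⟩ := key a
        obtain ⟨b', hb⟩ := key b
        refine Submodule.mem_sup.mpr ⟨_, ⟨a', rfl⟩, _, ⟨_, ⟨b', rfl⟩, rfl⟩, Subtype.ext ?_⟩
        change X.ι a' + σ p (X.ι b') = _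
        rw [LinearMap.mem_ker, map_add, hPσ] at hx
        rw [ha, hb, map_sub, sub_add_sub_comm, hx, sub_zero] }
  have hYr : ∀ y : LinearMap.ker P, y ∈ LinearMap.range Y.ι ↔ (y : X.E) ∈ LinearMap.range X.ι := by
    refine fun y => ⟨?_, ?_⟩
    · rintro ⟨u, rfl⟩
      exact ⟨u.1, rfl⟩
    · rintro ⟨u, hu⟩
      exact ⟨⟨u, by rw [Submodule.mem_comap, hu]; exact y.2⟩, Subtype.ext hu⟩
  refine ⟨F, Y, QuaternionicStructure.lowerHull_eq_bot (σ := σ.restrict hB) rfl ?_,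
    σ.restrict hA, σ.restrict hB, rfl, rfl,
    isomorphic_of_linearEquiv (τ := (σ.restrict hA).prod (σ.restrict hB)) hσ rfl
      (P.prodEquivOfIdempotent hPP) (fun p x => ?_) fun x => ?_⟩
  · rw [eq_bot_iff]
    intro x hx
    rw [HypercomplexStructure.mem_imCore] at hx
    -- A core vector of the factor is a core vector of the whole, so P fixes it; lying in ker P, it
    -- is zero.
    have hx' : (x : X.E) ∈ σ.imCore (LinearMap.range X.ι) :=
      (σ.mem_imCore).mpr fun p hp => (hYr _).mp (hx p hp)
    exact Subtype.ext ((hP _ hx').symm.trans x.2)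
  · refine Prod.ext (Subtype.ext (hPσ p x)) (Subtype.ext ?_)
    change σ p x - P (σ p x) = σ p (x - P x)
    rw [hPσ, map_sub]
  · constructor
    · intro hx
      obtain ⟨u, hu⟩ := (hYr ⟨x - P x, by simp [hPP]⟩).mpr (sub_mem hx (hPU x hx))
      exact ⟨(⟨⟨P x, x, rfl⟩, hPU x hx⟩, u), Prod.ext rfl hu⟩
    · rintro ⟨⟨u, v⟩, huv⟩
      have h1 : P x ∈ LinearMap.range X.ι := by
        have : u.1.1 = P x := congrArg Subtype.val (congrArg Prod.fst huv)
        exact this ▸ u.2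
      have h2 : x - P x ∈ LinearMap.range X.ι :=
        (hYr ⟨x - P x, by simp [hPP]⟩).mp ⟨v, congrArg Prod.snd huv⟩
      simpa using add_mem h1 h2

theorem CoCRQuaternionicSpace.exists_isDirectProduct (X : CoCRQuaternionicSpace.{u, v}) :
    ∃ (F : FQuaternionicSpace.{v}) (Y : CoCRQuaternionicSpace.{u, v}),
      Y.quat.upperHull (LinearMap.ker Y.ρ) = ⊤ ∧ X.IsDirectProduct F.toCoCR Y := by
  obtain ⟨σ, hσ⟩ : ∃ σ, X.quat.Admissible σ := Quotient.exists_rep X.quat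
  obtain ⟨P, hPσ, hPP, hPK, hspan, hdisj⟩ := σ.exists_splitting_imSpan (LinearMap.ker X.ρ)
  have hA : ∀ p, ∀ x ∈ LinearMap.range P, σ p x ∈ LinearMap.range P := by
    rintro p _ ⟨x, rfl⟩
    exact ⟨σ p x, hPσ p x⟩
  have hB : ∀ p, ∀ x ∈ LinearMap.ker P, σ p x ∈ LinearMap.ker P := by
    intro p x hx
    rw [LinearMap.mem_ker] at hx ⊢
    rw [hPσ, hx, map_zero]
  -- Any complement of K ∩ range P that contains (Im ℍ)K ∩ range P will do: it then contains J(K ∩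
  -- range P) for every J ∈ Z.
  obtain ⟨U, hSU, hUV⟩ : ∃ U : Submodule ℝ (LinearMap.range P),
      (σ.imSpan (LinearMap.ker X.ρ)).comap (LinearMap.range P).subtype ≤ U ∧
        IsCompl U ((LinearMap.ker X.ρ).comap (LinearMap.range P).subtype) := by
    refine Disjoint.exists_isCompl (Submodule.disjoint_def.mpr ?_)
    rintro ⟨_, x, rfl⟩ hS hK
    exact Subtype.ext (hdisj _ hK hS (hPP x))
  let F : FQuaternionicSpace.{v} :=
    { E := LinearMap.range P
      quat := (σ.restrict hA).toQuaternionic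
      U := U
      V := (LinearMap.ker X.ρ).comap (LinearMap.range P).subtype
      isF := by
        refine ⟨hUV, fun J hJ => ?_⟩
        obtain ⟨p, h0, -, rfl⟩ := (QuaternionicStructure.mem_Z_iff rfl).mp hJ
        rintro _ ⟨x, hx, rfl⟩
        exact hSU (σ.apply_mem_imSpan h0 hx) }
  let ρ : LinearMap.ker P →ₗ[ℝ] (LinearMap.ker P).map X.ρ :=
    X.ρ.restrict fun x hx => ⟨x, hx, rfl⟩
  have hker : ∀ y, y ∈ LinearMap.ker ρ ↔ (y : X.E) ∈ LinearMap.ker X.ρ := fun y =>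
    Subtype.ext_iff
  let Y : CoCRQuaternionicSpace.{u, v} :=
    { U := (LinearMap.ker P).map X.ρ
      E := LinearMap.ker P
      quat := (σ.restrict hB).toQuaternionic
      ρ := ρ
      isCoCR := by
        rw [isCoCRQuaternionic_iff]
        refine ⟨?_, fun J hJ => ?_⟩
        · rintro ⟨_, x, hx, rfl⟩
          exact ⟨⟨x, hx⟩, rfl⟩
        · obtain ⟨p, h0, h1, rfl⟩ := (QuaternionicStructure.mem_Z_iff rfl).mp hJ
          have hX := ((isCoCRQuaternionic_iff _ _).mp X.isCoCR).2 (σ p)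
            ((QuaternionicStructure.mem_Z_iff hσ).mpr ⟨p, h0, h1, rfl⟩)
          rw [eq_bot_iff] at hX ⊢
          rintro _ ⟨hx, y, hy, rfl⟩
          exact Subtype.ext (hX ⟨(hker _).mp hx, y, (hker _).mp hy, rfl⟩) }
  refine ⟨F, Y, QuaternionicStructure.upperHull_eq_top (σ := σ.restrict hB) rfl ?_,
    σ.restrict hA, σ.restrict hB, rfl, rfl,
    isomorphic_of_linearEquiv (τ := (σ.restrict hA).prod (σ.restrict hB)) hσ rfl
      (P.prodEquivOfIdempotent hPP) (fun p x => ?_) fun x => ?_⟩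
  · have hle : σ.imSpan (LinearMap.ker X.ρ ⊓ LinearMap.ker P) ≤
        ((σ.restrict hB).imSpan (LinearMap.ker ρ)).map (LinearMap.ker P).subtype := by
      refine (σ.imSpan_le).mpr fun p hp x hx => ?_
      exact ⟨σ.restrict hB p ⟨x, hx.2⟩,
        (σ.restrict hB).apply_mem_imSpan hp ((hker ⟨x, hx.2⟩).mpr hx.1), rfl⟩
    rw [eq_top_iff]
    intro x _
    obtain ⟨y, hy, hyx⟩ := hle (hspan x x.2)
    rwa [← Subtype.ext hyx]
  · refine Prod.ext (Subtype.ext (hPσ p x)) (Subtype.ext ?_)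
    change σ p x - P (σ p x) = σ p (x - P x)
    rw [hPσ, map_sub]
  · have h1 : ∀ y : LinearMap.range P, F.toCoCR.ρ y = 0 ↔ (y : X.E) ∈ LinearMap.ker X.ρ :=
      fun y => Submodule.projectionOnto_apply_eq_zero_iff hUV
    have h2 : P.prodEquivOfIdempotent hPP x ∈
          LinearMap.ker (F.toCoCR.prod Y (σ.restrict hA) (σ.restrict hB) rfl rfl).ρ ↔
        P x ∈ LinearMap.ker X.ρ ∧ x - P x ∈ LinearMap.ker X.ρ :=
      Prod.ext_iff.trans (and_congr (h1 _) (hker _))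
    refine Iff.trans ?_ h2.symm
    -- Since P preserves K = ker ρ, x lies in K exactly when both of its components Px and x - Px
    -- do.
    exact ⟨fun hx => ⟨hPK x hx, sub_mem hx (hPK x hx)⟩, fun h => by simpa using add_mem h.1 h.2⟩

theorem theoremB4 :
    (∀ X : CRQuaternionicSpace.{u, v},
      ∃ (F : FQuaternionicSpace.{v}) (Y : CRQuaternionicSpace.{u, v}),
        Y.quat.lowerHull (LinearMap.range Y.ι) = ⊥ ∧ X.IsDirectProduct F.toCR Y) ∧
    (∀ X : CoCRQuaternionicSpace.{u, v},
      ∃ (F : FQuaternionicSpace.{v}) (Y : CoCRQuaternionicSpace.{u, v}),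
        Y.quat.upperHull (LinearMap.ker Y.ρ) = ⊤ ∧ X.IsDirectProduct F.toCoCR Y) :=
  ⟨CRQuaternionicSpace.exists_isDirectProduct, CoCRQuaternionicSpace.exists_isDirectProduct⟩
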